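/- Let $\Omega=(a,b)\times(c,d)\subset\mathbb R^2$, $T>0$, $\alpha\in(0,1)$, and let $\epsilon_0,\epsilon_\infty,\mu_0,\tau_0>0$ and $\epsilon_s>\epsilon_\infty$. Write $(\cdot,\cdot)$ and $\|\cdot\|$ for the inner product and norm of $L^2(\Omega)$ (scalar or $\mathbb R^2$-valued). Let $(\mathcal I^{\beta}u)(t)=\frac1{\Gamma(\beta)}\int_0^t (t-s)^{\beta-1}u(s)\,ds$ be the Riemann--Liouville integral, $\partial_t^\alpha u=\mathcal I^{1-\alpha}\partial_t u$ the Caputo derivative, and $\eta_\alpha(t)=t^{\alpha-1}/\Gamma(\alpha)$. For vector fields put $\nabla\times\boldsymbol v=\partial_x v_2-\partial_y v_1$ in the weak sense, and let $H_0(\mathrm{curl};\Omega)$ be the space of $\boldsymbol v\in L^2(\Omega)^2$ with $\nabla\times\boldsymbol v\in L^2(\Omega)$ and vanishing tangential trace $\boldsymbol n\times\boldsymbol v=0$ on $\partial\Omega$. Let $\boldsymbol E\in C((0,T);H_0(\mathrm{curl};\Omega))$, and let $\boldsymbol E,\boldsymbol P$ (with values in $L^2(\Omega)^2$) and $H$ (with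 values in $L^2(\Omega)$) be continuous in time on $[0,T]$ and continuously differentiable in time on $(0,T)$. Suppose that for almost every $\boldsymbol x\in\Omega$ the function $\boldsymbol P(\boldsymbol x,\cdot)$ is absolutely continuous on $[0,T]$, i.e. $\partial_t\boldsymbol P(\boldsymbol x,\cdot)\in L^1(0,T)$, and $\partial_t^\alpha\boldsymbol P(\boldsymbol x,\cdot)$ extends continuously from $(0,T)$ to $[0,T]$; and that $\partial_t^\alpha\boldsymbol P(t)\in L^2(\Omega)^2$ for $t\in(0,T)$. Suppose that for every $t\in(0,T)$ $$\epsilon_0\epsilon_\infty(\partial_t\boldsymbol E,\boldsymbol\chi)+(\partial_t\boldsymbol P,\boldsymbol\chi)-(H,\nabla\times\boldsymbol\chi)=0\quad\forall\boldsymbol\chi\in H_0(\mathrm{curl};\Omega),$$ $$\mu_0(\partial_t H,\phi)+(\nabla\times\boldsymbol E,\phi)=0\quad\forall\phi\in L^2(\Omega),$$ $$\tau_0^\alpha(\partial_t^\alpha\boldsymbol P,\boldsymbol\psi)+(\boldsymbol P,\boldsymbol\psi)-\epsilon_0(\epsilon_s-\epsilon_\infty)(\boldsymbol E,\boldsymbol\psi)=0\quad\forall\boldsymbol\psi\in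 L^2(\Omega)^2.$$ Define $$\mathcal E_\alpha(t)=\tau_0^\alpha\,\mathcal I^\alpha\big(\|\partial_t^\alpha\boldsymbol P\|^2\big)(t)+\|\boldsymbol P(t)\|^2+\epsilon_0(\epsilon_s-\epsilon_\infty)\big(\epsilon_0\epsilon_\infty\|\boldsymbol E(t)\|^2+\mu_0\|H(t)\|^2\big).$$ Then $\mathcal E_\alpha$ is differentiable on $(0,T)$ and $$\frac{d}{dt}\mathcal E_\alpha(t)+\tau_0^\alpha\,\eta_\alpha(t)\,\|\partial_t^\alpha\boldsymbol P(t)\|^2\le 0\qquad\text{for all }t\in(0,T),$$ and consequently $\mathcal E_\alpha(t_1)\le\mathcal E_\alpha(t_2)$ whenever $0\le t_2\le t_1\le T$. -/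

import Mathlib

open MeasureTheory Set
open scoped ContDiff

noncomputable section

namespace ColeCole

/-- The plane `ℝ²` with its Euclidean norm. -/
abbrev Plane := EuclideanSpace ℝ (Fin 2)

/-- The open rectangle `(a,b) × (c,d)`. -/
def rectangle (a b c d : ℝ) : Set Plane :=
  {x | x 0 ∈ Ioo a b ∧ x 1 ∈ Ioo c d}

/-- The space `L²(Ω; F)`; its norm and inner product are the usual `L²(Ω)` ones. -/
abbrev L2 (Ω : Set Plane) (F : Type) [NormedAddCommGroup F] :=
  Lp F 2 (volume.restrict Ω)

open Classical in
/-- The class in `L²(Ω; F)` of a square integrable function (and `0` for any other function). -/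
def toL2 {F : Type} [NormedAddCommGroup F] (Ω : Set Plane) (f : Plane → F) : L2 Ω F :=
  if h : MemLp f 2 (volume.restrict Ω) then h.toLp f else 0

/-! ### The curl operators and `H₀(curl; Ω)` -/

/-- The vector curl `(∂φ/∂y, -∂φ/∂x)` of a scalar function. -/
def curlScalar (φ : Plane → ℝ) (x : Plane) : Plane :=
  !₂[fderiv ℝ φ x (EuclideanSpace.single 1 1), -fderiv ℝ φ x (EuclideanSpace.single 0 1)]

/-- `w = ∂v₂/∂x - ∂v₁/∂y` in the sense of distributions on `Ω`. -/
def IsWeakCurl (Ω : Set Plane) (v : Plane → Plane) (w : Plane → ℝ) : Prop :=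
  ∀ φ : Plane → ℝ, ContDiff ℝ ∞ φ → HasCompactSupport φ → tsupport φ ⊆ Ω →
    ∫ x in Ω, w x * φ x = ∫ x in Ω, inner ℝ (v x) (curlScalar φ x)

/-- `v ∈ H(curl; Ω)`: both `v` and its distributional curl are square integrable. -/
def MemHCurl (Ω : Set Plane) (v : Plane → Plane) : Prop :=
  MemLp v 2 (volume.restrict Ω) ∧
    ∃ w : Plane → ℝ, MemLp w 2 (volume.restrict Ω) ∧ IsWeakCurl Ω v w

open Classical in
/-- The (almost everywhere unique) square integrable weak curl of a field in `H(curl; Ω)`. -/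
def curl (Ω : Set Plane) (v : Plane → Plane) : Plane → ℝ :=
  if h : ∃ w : Plane → ℝ, MemLp w 2 (volume.restrict Ω) ∧ IsWeakCurl Ω v w then h.choose else 0

/-- `v ∈ H₀(curl; Ω)`. The tangential trace `n × v` of a field in `H(curl; Ω)` is the functional
`φ ↦ (curl v, φ) - (v, curl φ)`, and it is required to vanish; here `φ` ranges over the
restrictions to `Ω` of smooth compactly supported functions on the whole plane. -/
def MemH0Curl (Ω : Set Plane) (v : Plane → Plane) : Prop :=
  MemHCurl Ω v ∧
    ∀ φ : Plane → ℝ, ContDiff ℝ ∞ φ → HasCompactSupport φ →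
      ∫ x in Ω, curl Ω v x * φ x = ∫ x in Ω, inner ℝ (v x) (curlScalar φ x)

/-! ### Fractional calculus -/

/-- The Riemann-Liouville fractional integral of order `α`,
`(I^α u)(t) = Γ(α)⁻¹ ∫₀ᵗ (t - s)^(α - 1) u(s) ds`. -/
def fracIntegral {F : Type} [NormedAddCommGroup F] [NormedSpace ℝ F]
    (α : ℝ) (u : ℝ → F) (t : ℝ) : F :=
  (Real.Gamma α)⁻¹ • ∫ s in (0 : ℝ)..t, (t - s) ^ (α - 1) • u s

/-- The Caputo derivative of order `α`, `I^(1 - α) u'`. -/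
def caputo {F : Type} [NormedAddCommGroup F] [NormedSpace ℝ F]
    (α : ℝ) (u : ℝ → F) (t : ℝ) : F :=
  fracIntegral (1 - α) (deriv u) t

/-- `η_α(t) = t^(α - 1) / Γ(α)`. -/
def eta (α t : ℝ) : ℝ := t ^ (α - 1) / Real.Gamma α

/-- `u' ∈ L¹(0,T)`, that is, `u` is absolutely continuous on `[0,T]`: it is the integral of its
almost everywhere derivative. -/
def HasL1Deriv (T : ℝ) (u : ℝ → Plane) : Prop :=
  IntervalIntegrable (deriv u) volume 0 T ∧
    ∀ t ∈ Icc 0 T, u t = u 0 + ∫ s in (0 : ℝ)..t, deriv u s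

/-- `∂_t^α u ∈ C[0,T]`: the Caputo derivative on `(0,T)` extends continuously to `[0,T]`.
(The limit at `0` need not be `0`, as `u(t) = t ^ α` shows.) -/
def HasContCaputo (T α : ℝ) (u : ℝ → Plane) : Prop :=
  ∃ g : ℝ → Plane, ContinuousOn g (Icc 0 T) ∧ EqOn (caputo α u) g (Ioo 0 T)

/-- The field `x ↦ ∂_t^α P(x,t)`. -/
def caputoField (α : ℝ) (P : ℝ → Plane → Plane) (t : ℝ) : Plane → Plane :=
  fun x => caputo α (fun s => P s x) t

/-! ### The Cole-Cole model -/

/-- The material parameters: permittivities `ε₀`, `ε_∞`, `ε_s` with `ε_s > ε_∞`, permeability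
`μ₀` and relaxation time `τ₀`. -/
structure Medium where
  eps0 : ℝ
  epsInf : ℝ
  epsS : ℝ
  mu0 : ℝ
  tau0 : ℝ
  eps0_pos : 0 < eps0
  epsInf_pos : 0 < epsInf
  epsInf_lt_epsS : epsInf < epsS
  mu0_pos : 0 < mu0
  tau0_pos : 0 < tau0

/-- `u ∈ C([0,T]; L²(Ω)) ∩ C¹((0,T); L²(Ω))`. -/
structure IsC1L2 {F : Type} [NormedAddCommGroup F] [NormedSpace ℝ F]
    (Ω : Set Plane) (T : ℝ) (u : ℝ → Plane → F) : Prop where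
  memLp : ∀ t ∈ Icc 0 T, MemLp (u t) 2 (volume.restrict Ω)
  continuousOn : ContinuousOn (fun t => toL2 Ω (u t)) (Icc 0 T)
  contDiffOn : ContDiffOn ℝ 1 (fun t => toL2 Ω (u t)) (Ioo 0 T)

/-- The time derivative, in `L²(Ω)`, of a time dependent field. -/
def dt {F : Type} [NormedAddCommGroup F] [NormedSpace ℝ F]
    (Ω : Set Plane) (u : ℝ → Plane → F) (t : ℝ) : L2 Ω F :=
  deriv (fun s => toL2 Ω (u s)) t

/-- `(E, H, P)` is a weak solution on `Ω × (0,T)` of Maxwell's equations in the Cole-Cole medium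
`M` with exponent `α`. -/
structure IsWeakSolution (M : Medium) (α T : ℝ) (Ω : Set Plane)
    (E : ℝ → Plane → Plane) (H : ℝ → Plane → ℝ) (P : ℝ → Plane → Plane) : Prop where
  regE : IsC1L2 Ω T E
  regH : IsC1L2 Ω T H
  regP : IsC1L2 Ω T P
  memE : ∀ t ∈ Ioo 0 T, MemH0Curl Ω (E t)
  contCurlE : ContinuousOn (fun t => toL2 Ω (curl Ω (E t))) (Ioo 0 T)
  regPt : ∀ᵐ x ∂(volume.restrict Ω),
    HasL1Deriv T (fun t => P t x) ∧ HasContCaputo T α (fun t => P t x)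
  memCaputo : ∀ t ∈ Ioo 0 T, MemLp (caputoField α P t) 2 (volume.restrict Ω)
  ampere : ∀ t ∈ Ioo 0 T, ∀ χ : Plane → Plane, MemH0Curl Ω χ →
    M.eps0 * M.epsInf * inner ℝ (dt Ω E t) (toL2 Ω χ) + inner ℝ (dt Ω P t) (toL2 Ω χ)
      - inner ℝ (toL2 Ω (H t)) (toL2 Ω (curl Ω χ)) = 0
  faraday : ∀ t ∈ Ioo 0 T, ∀ φ : L2 Ω ℝ,
    M.mu0 * inner ℝ (dt Ω H t) φ + inner ℝ (toL2 Ω (curl Ω (E t))) φ = 0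
  polarization : ∀ t ∈ Ioo 0 T, ∀ ψ : L2 Ω Plane,
    M.tau0 ^ α * inner ℝ (toL2 Ω (caputoField α P t)) ψ + inner ℝ (toL2 Ω (P t)) ψ
      - M.eps0 * (M.epsS - M.epsInf) * inner ℝ (toL2 Ω (E t)) ψ = 0

/-- The modified energy
`τ₀^α I^α ‖∂_t^α P‖² + ‖P‖² + ε₀ (ε_s - ε_∞) (ε₀ ε_∞ ‖E‖² + μ₀ ‖H‖²)`. -/
def energy (M : Medium) (α : ℝ) (Ω : Set Plane)
    (E : ℝ → Plane → Plane) (H : ℝ → Plane → ℝ) (P : ℝ → Plane → Plane) (t : ℝ) : ℝ :=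
  M.tau0 ^ α * fracIntegral α (fun s => ‖toL2 Ω (caputoField α P s)‖ ^ 2) t
    + ‖toL2 Ω (P t)‖ ^ 2
    + M.eps0 * (M.epsS - M.epsInf) *
      (M.eps0 * M.epsInf * ‖toL2 Ω (E t)‖ ^ 2 + M.mu0 * ‖toL2 Ω (H t)‖ ^ 2)

end ColeCole

end

namespace ColeCole

open Filter Topology

/-! ### Riemann–Liouville and Caputo calculus -/

section FractionalCalculus

/-! Write `G = ∂_t^α P`. The polarization law expresses `G` through `E` and `P`, so as an
`L²(Ω)`-valued function it is continuous on `[0,T]` and `C¹` on `(0,T)`. Since `I^α I^(1-α)` is the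
ordinary primitive, `I^α G = P - P(0)`, hence `(I^α G)' = ∂_t P`.

The core is `deriv_fracIntegral_norm_sq_add_le`: `(I^α ‖G‖²)' + η_α ‖G‖² ≤ 2 (G, ∂_t P)`. Fix `t`
and expand `‖G(s) - G(t)‖²` with `G(t)` frozen. The difference of the two sides is then minus the
derivative at `t` of `I^α` of this nonnegative function of `s`. That derivative is nonpositive
because the function vanishes at `s = t` and the kernel decreases
(`deriv_fracIntegral_nonpos_of_eq_zero`).

Multiply by `τ₀^α` and test the polarization law with `2 ∂_t P`. The right-hand side becomes `-2 (P,
∂_t P)` plus a multiple of `(E, ∂_t P)`, which Poynting's identity cancels against the field energy.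

The Caputo derivative is taken pointwise in `x`, whereas `I^α G` is an `L²(Ω)`-valued integral.
`fracIntegral_eq_toL2_sub` identifies them by evaluating both with the same quadrature sums. -/

lemma intervalIntegrable_kernel {β : ℝ} (hβ : 0 < β) (t p q : ℝ) :
    IntervalIntegrable (fun s => (t - s) ^ (β - 1)) volume p q := by
  have h := (intervalIntegral.intervalIntegrable_rpow' (a := t - p) (b := t - q)
    (r := β - 1) (by linarith)).comp_sub_left t
  simpa using h

lemma measurable_kernel (β t : ℝ) : Measurable fun s : ℝ => (t - s) ^ (β - 1) := by
  fun_prop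

/-- Euler's beta integral with complementary exponents, on an interval of length `L`. -/
lemma integral_complementary_kernel {α : ℝ} (hα : α ∈ Ioo (0 : ℝ) 1) {L : ℝ} (hL : 0 < L) :
    ∫ x in (0 : ℝ)..L, x ^ (-α) * (L - x) ^ (α - 1)
      = Real.Gamma α * Real.Gamma (1 - α) := by
  have h := Complex.betaIntegral_scaled ((1 - α : ℝ) : ℂ) (α : ℂ) hL
  have hb := Complex.betaIntegral_eq_Gamma_mul_div ((1 - α : ℝ) : ℂ) (α : ℂ)
    (by simpa using hα.2) (by simpa using hα.1)
  rw [hb] at h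
  -- The exponents add up to `1`, so the power of `L` and the denominator `Γ(1)` both disappear.
  have h0 : ((1 - α : ℝ) : ℂ) + (α : ℂ) = 1 := by push_cast; ring
  rw [h0, sub_self, Complex.cpow_zero, one_mul, Complex.Gamma_one, div_one,
    Complex.Gamma_ofReal, Complex.Gamma_ofReal] at h
  have h2 : ∫ x in (0 : ℝ)..L, ((x : ℂ) ^ (((1 - α : ℝ) : ℂ) - 1) * ((L : ℂ) - x) ^ ((α : ℂ) - 1))
      = ((∫ x in (0 : ℝ)..L, x ^ (-α) * (L - x) ^ (α - 1) : ℝ) : ℂ) := by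
    rw [← intervalIntegral.integral_ofReal]
    refine intervalIntegral.integral_congr_Ioo_of_le hL.le fun x hx => ?_
    have hx2 : 0 ≤ L - x := by linarith [hx.2]
    rw [Complex.ofReal_mul, Complex.ofReal_cpow hx.1.le, Complex.ofReal_cpow hx2]
    push_cast
    congr 2
    ring
  rw [h2] at h
  rw [mul_comm (Real.Gamma α)]
  exact_mod_cast h

lemma integral_complementary_kernel_shift {α : ℝ} (hα : α ∈ Ioo (0 : ℝ) 1) {r t : ℝ}
    (hrt : r < t) :
    ∫ s in r..t, (t - s) ^ (α - 1) * (s - r) ^ (-α)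
      = Real.Gamma α * Real.Gamma (1 - α) := by
  rw [← integral_complementary_kernel hα (sub_pos.2 hrt)]
  have h := intervalIntegral.integral_comp_sub_right (a := r) (b := t)
    (fun x => x ^ (-α) * (t - r - x) ^ (α - 1)) r
  rw [sub_self] at h
  rw [← h]
  congr 1
  ext s
  rw [mul_comm, sub_sub_sub_cancel_right]

lemma Gamma_mul_Gamma_one_sub_pos {α : ℝ} (hα : α ∈ Ioo (0 : ℝ) 1) :
    0 < Real.Gamma α * Real.Gamma (1 - α) :=
  mul_pos (Real.Gamma_pos_of_pos hα.1) (Real.Gamma_pos_of_pos (sub_pos.2 hα.2))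

/-- A non-integrable function has integral `0` by convention, but this integral is positive. -/
lemma intervalIntegrable_complementary_kernel {α : ℝ} (hα : α ∈ Ioo (0 : ℝ) 1) {r t : ℝ}
    (hrt : r < t) :
    IntervalIntegrable (fun s => (t - s) ^ (α - 1) * (s - r) ^ (-α)) volume r t := by
  by_contra h
  have h1 := integral_complementary_kernel_shift hα hrt
  rw [intervalIntegral.integral_undef h] at h1
  exact (Gamma_mul_Gamma_one_sub_pos hα).ne h1

variable {F : Type} [NormedAddCommGroup F] [NormedSpace ℝ F]

/-- The composition of the Riemann-Liouville integrals of orders `α` and `1 - α` is the ordinary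
primitive. -/
lemma integral_kernel_smul_integral_kernel [CompleteSpace F] {α : ℝ} (hα : α ∈ Ioo (0 : ℝ) 1) {t : ℝ}
    (ht : 0 ≤ t) {f : ℝ → F} (hf : IntervalIntegrable f volume 0 t) :
    ∫ s in (0 : ℝ)..t, (t - s) ^ (α - 1) • ∫ r in (0 : ℝ)..s, (s - r) ^ (-α) • f r
      = (Real.Gamma α * Real.Gamma (1 - α)) • ∫ r in (0 : ℝ)..t, f r := by
  set B := Real.Gamma α * Real.Gamma (1 - α) with hB
  -- Extending the kernel by zero off the triangle `r < s` lets Fubini be applied on a square.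
  set k : ℝ → ℝ → ℝ := fun s r => if r < s then (t - s) ^ (α - 1) * (s - r) ^ (-α) else 0 with hk
  set μ : Measure ℝ := volume.restrict (Ioc 0 t) with hμ
  have hfμ : Integrable f μ := by
    rw [intervalIntegrable_iff_integrableOn_Ioc_of_le ht] at hf
    exact hf
  have hkmeas : Measurable (Function.uncurry k) := by
    refine Measurable.ite ?_ (by fun_prop) measurable_const
    exact measurableSet_lt measurable_snd measurable_fst
  have hknn : ∀ s ∈ Ioc 0 t, ∀ r, 0 ≤ k s r := by
    intro s hs r
    simp only [hk]
    split_ifs with h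
    · exact mul_nonneg (Real.rpow_nonneg (by linarith [hs.2]) _)
        (Real.rpow_nonneg (by linarith) _)
    · exact le_rfl
  have hkind : ∀ r, (fun s => k s r)
      = (Ioi r).indicator (fun s => (t - s) ^ (α - 1) * (s - r) ^ (-α)) := by
    intro r
    ext s
    simp [hk, indicator]
  have hinter : ∀ r, 0 ≤ r → Ioc 0 t ∩ Ioi r = Ioc r t := by
    intro r hr
    ext s
    simp only [mem_inter_iff, mem_Ioc, mem_Ioi]
    constructor
    · rintro ⟨⟨_, h2⟩, h3⟩
      exact ⟨h3, h2⟩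
    · rintro ⟨h2, h3⟩
      exact ⟨⟨by linarith, h3⟩, h2⟩
  have hkint : ∀ r, 0 ≤ r → r < t → Integrable (fun s => k s r) μ := by
    intro r hr hrt
    rw [hkind r, hμ, integrable_indicator_iff measurableSet_Ioi, IntegrableOn,
      Measure.restrict_restrict measurableSet_Ioi, inter_comm, hinter r hr]
    exact (intervalIntegrable_iff_integrableOn_Ioc_of_le hrt.le).1
      (intervalIntegrable_complementary_kernel hα hrt)
  have hkB : ∀ r, 0 ≤ r → r < t → ∫ s, k s r ∂μ = B := by
    intro r hr hrt
    rw [hkind r, hμ, setIntegral_indicator measurableSet_Ioi, hinter r hr,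
      ← intervalIntegral.integral_of_le hrt.le, integral_complementary_kernel_shift hα hrt]
  -- At `r = t` the inner integral is `0` instead of `B`; this null set is discarded.
  have hae : ∀ᵐ r ∂μ, 0 ≤ r ∧ r < t := by
    have h1 : ∀ᵐ r ∂(volume : Measure ℝ), r ≠ t := by
      simp [ae_iff, measure_singleton]
    rw [hμ, ae_restrict_iff' measurableSet_Ioc]
    filter_upwards [h1] with r hr hr2
    exact ⟨hr2.1.le, lt_of_le_of_ne hr2.2 hr⟩
  have hint : Integrable (Function.uncurry fun s r => k s r • f r) (μ.prod μ) := by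
    rw [integrable_prod_iff']
    · constructor
      · filter_upwards [hae] with r hr
        exact (hkint r hr.1 hr.2).smul_const (f r)
      · refine (hfμ.norm.const_mul B).congr ?_
        filter_upwards [hae] with r hr
        have h1 : ∫ s, ‖k s r • f r‖ ∂μ = ∫ s, k s r * ‖f r‖ ∂μ := by
          refine setIntegral_congr_fun measurableSet_Ioc fun s hs => ?_
          rw [norm_smul, Real.norm_of_nonneg (hknn s hs r)]
        simp only [Function.uncurry]
        rw [h1, integral_mul_const, hkB r hr.1 hr.2]
    · exact hkmeas.aestronglyMeasurable.smul hfμ.aestronglyMeasurable.comp_snd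
  have hswap := integral_integral_swap hint
  have hleft : ∫ s in (0 : ℝ)..t, (t - s) ^ (α - 1) • ∫ r in (0 : ℝ)..s, (s - r) ^ (-α) • f r
      = ∫ s, ∫ r, k s r • f r ∂μ ∂μ := by
    rw [intervalIntegral.integral_of_le ht]
    refine setIntegral_congr_fun measurableSet_Ioc fun s hs => ?_
    have h1 : (fun r => k s r • f r)
        = (Iio s).indicator (fun r => (t - s) ^ (α - 1) • (s - r) ^ (-α) • f r) := by
      ext r
      simp only [hk, indicator, mem_Iio]
      split_ifs
      · rw [mul_smul]
      · rw [zero_smul]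
    have h2 : Ioc 0 t ∩ Iio s = Ioo 0 s := by
      ext r
      simp only [mem_inter_iff, mem_Ioc, mem_Iio, mem_Ioo]
      constructor
      · rintro ⟨⟨h3, _⟩, h4⟩
        exact ⟨h3, h4⟩
      · rintro ⟨h3, h4⟩
        exact ⟨⟨h3, h4.le.trans hs.2⟩, h4⟩
    rw [h1, hμ, setIntegral_indicator measurableSet_Iio, h2, ← integral_Ioc_eq_integral_Ioo,
      ← intervalIntegral.integral_of_le hs.1.le, intervalIntegral.integral_smul]
  rw [hleft, hswap, intervalIntegral.integral_of_le ht, ← integral_smul]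
  refine integral_congr_ae ?_
  filter_upwards [hae] with r hr
  rw [integral_smul_const, hkB r hr.1 hr.2]

lemma fracIntegral_caputo [CompleteSpace F] {α : ℝ} (hα : α ∈ Ioo (0 : ℝ) 1) {t : ℝ} (ht : 0 ≤ t) {u : ℝ → F}
    (hu : IntervalIntegrable (deriv u) volume 0 t) :
    fracIntegral α (caputo α u) t = ∫ r in (0 : ℝ)..t, deriv u r := by
  have hΓ := Gamma_mul_Gamma_one_sub_pos hα
  have h1 : ∀ s, (t - s) ^ (α - 1) • caputo α u s = (Real.Gamma (1 - α))⁻¹ •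
      ((t - s) ^ (α - 1) • ∫ r in (0 : ℝ)..s, (s - r) ^ (-α) • deriv u r) := by
    intro s
    rw [caputo, fracIntegral, sub_sub_cancel_left, smul_comm]
  simp only [fracIntegral, h1]
  rw [intervalIntegral.integral_smul, integral_kernel_smul_integral_kernel hα ht hu, smul_smul,
    smul_smul, ← mul_inv, inv_mul_cancel₀ hΓ.ne', one_smul]

lemma fracIntegral_congr {α t : ℝ} (ht : 0 ≤ t) {u v : ℝ → F} (h : EqOn u v (Ioo 0 t)) :
    fracIntegral α u t = fracIntegral α v t := by
  unfold fracIntegral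
  congr 1
  refine intervalIntegral.integral_congr_Ioo_of_le ht fun s hs => ?_
  simp only [h hs]

lemma intervalIntegrable_kernel_smul {β : ℝ} (hβ : 0 < β) (τ : ℝ) {p q : ℝ} {u : ℝ → F}
    (hpq : p ≤ q) (hu : ContinuousOn u (Icc p q)) :
    IntervalIntegrable (fun s => (τ - s) ^ (β - 1) • u s) volume p q :=
  (intervalIntegrable_kernel hβ τ p q).smul_continuousOn (by rwa [uIcc_of_le hpq])

/-- The fractional integral after scaling to the unit interval. -/
lemma fracIntegral_eq_scaled {α : ℝ} (hα : 0 < α) {t : ℝ} (ht : 0 ≤ t) (u : ℝ → F) :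
    fracIntegral α u t = (Real.Gamma α)⁻¹ • t ^ α •
      ∫ σ in (0 : ℝ)..1, (1 - σ) ^ (α - 1) • u (t * σ) := by
  unfold fracIntegral
  congr 1
  rcases ht.eq_or_lt with rfl | ht
  · simp [Real.zero_rpow hα.ne']
  have h := intervalIntegral.smul_integral_comp_mul_left (a := 0) (b := 1)
    (fun s => (t - s) ^ (α - 1) • u s) t
  rw [mul_zero, mul_one] at h
  rw [← h]
  have h1 : t ^ α = t * t ^ (α - 1) := by
    rw [← Real.rpow_one_add' ht.le (by linarith)]
    congr 1
    ring
  rw [h1, mul_smul]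
  congr 1
  rw [← intervalIntegral.integral_smul]
  refine intervalIntegral.integral_congr_Ioo_of_le zero_le_one fun σ hσ => ?_
  rw [smul_smul, ← Real.mul_rpow ht.le (by linarith [hσ.2])]
  congr 2
  ring

/-- After scaling, the singular kernel no longer depends on `t`, and dominated convergence applies.
-/
lemma continuousOn_fracIntegral {α : ℝ} (hα : 0 < α) {T : ℝ} (hT : 0 ≤ T) {u : ℝ → F}
    (hu : ContinuousOn u (Icc 0 T)) : ContinuousOn (fracIntegral α u) (Icc 0 T) := by
  -- The extension by endpoint values is continuous and bounded on the whole line.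
  set v : ℝ → F := IccExtend hT ((Icc 0 T).domRestrict u) with hv
  have hvc : Continuous v := (continuousOn_iff_continuous_domRestrict.1 hu).Icc_extend'
  have hvu : EqOn u v (Icc 0 T) := fun s hs => by rw [hv, IccExtend_of_mem hT _ hs]; rfl
  obtain ⟨C, hC⟩ : ∃ C, ∀ s, ‖v s‖ ≤ C := by
    obtain ⟨C, hC⟩ := isCompact_Icc.exists_bound_of_continuousOn hu
    exact ⟨C, fun s => hC _ (projIcc 0 T hT s).2⟩
  have hcont : Continuous fun t : ℝ => (Real.Gamma α)⁻¹ • t ^ α •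
      ∫ σ in (0 : ℝ)..1, (1 - σ) ^ (α - 1) • v (t * σ) := by
    refine continuous_const.smul ((Real.continuous_rpow_const hα.le).smul ?_)
    refine intervalIntegral.continuous_of_dominated_interval
      (bound := fun σ => (1 - σ) ^ (α - 1) * C) (fun t => ?_) (fun t => ?_)
      ((intervalIntegrable_kernel hα 1 0 1).mul_const C) ?_
    · exact (measurable_kernel α 1).aestronglyMeasurable.smul
        (hvc.comp (continuous_const.mul continuous_id)).aestronglyMeasurable
    · refine Eventually.of_forall fun σ hσ => ?_
      rw [uIoc_of_le zero_le_one] at hσ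
      have h0 : 0 ≤ (1 - σ) ^ (α - 1) := Real.rpow_nonneg (by linarith [hσ.2]) _
      rw [norm_smul, Real.norm_of_nonneg h0]
      exact mul_le_mul_of_nonneg_left (hC _) h0
    · exact Eventually.of_forall fun σ _ => continuous_const.smul
        (hvc.comp (continuous_id.mul continuous_const))
  refine hcont.continuousOn.congr fun t ht => ?_
  refine Eq.trans ?_ (fracIntegral_eq_scaled hα ht.1 v)
  exact fracIntegral_congr ht.1 fun s hs => hvu ⟨hs.1.le, hs.2.le.trans ht.2⟩

lemma fracIntegral_const {α : ℝ} (hα : 0 < α) (t c : ℝ) :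
    fracIntegral α (fun _ => c) t = c * (t ^ α / (α * Real.Gamma α)) := by
  unfold fracIntegral
  simp only [smul_eq_mul]
  rw [intervalIntegral.integral_mul_const,
    intervalIntegral.integral_comp_sub_left (fun x => x ^ (α - 1)), sub_self, sub_zero,
    integral_rpow (Or.inl (by linarith)), sub_add_cancel, Real.zero_rpow hα.ne', sub_zero]
  have := (Real.Gamma_pos_of_pos hα).ne'
  field_simp

lemma hasDerivAt_rpow_div_Gamma {α : ℝ} (hα : 0 < α) {t : ℝ} (ht : 0 < t) :
    HasDerivAt (fun t => t ^ α / (α * Real.Gamma α)) (eta α t) t := by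
  have h := (Real.hasDerivAt_rpow_const (p := α) (Or.inl ht.ne')).div_const (α * Real.Gamma α)
  rwa [mul_div_mul_left _ _ hα.ne'] at h

end FractionalCalculus

/-! ### Differentiability of fractional integrals -/

section Differentiability

lemma locallyIntegrable_rpow_indicator {α : ℝ} (hα : 0 < α) :
    LocallyIntegrable ((Ioi (0 : ℝ)).indicator fun r : ℝ => r ^ (α - 1)) volume := by
  refine LocallyIntegrable.indicator (fun x => ?_) measurableSet_Ioi
  refine ⟨Ioc (x - 1) (x + 1), Ioc_mem_nhds (by linarith) (by linarith), ?_⟩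
  exact (intervalIntegral.intervalIntegrable_rpow' (a := x - 1) (b := x + 1)
    (r := α - 1) (by linarith)).1

/-- For positive times this is a convolution over the whole line with a locally integrable kernel,
so the derivative can be put on `w`. -/
lemma differentiableAt_fracIntegral_of_hasCompactSupport {α : ℝ} (hα : 0 < α) {w : ℝ → ℝ}
    (hw : ContDiff ℝ 1 w) (hc : HasCompactSupport w) (h0 : ∀ s ≤ 0, w s = 0) {t : ℝ}
    (ht : 0 < t) : DifferentiableAt ℝ (fracIntegral α w) t := by
  set k : ℝ → ℝ := (Ioi (0 : ℝ)).indicator fun r : ℝ => r ^ (α - 1) with hk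
  have hconv : ContDiff ℝ 1 (convolution k w (ContinuousLinearMap.lsmul ℝ ℝ) volume) :=
    hc.contDiff_convolution_right (n := 1) _ (locallyIntegrable_rpow_indicator hα) hw
  have hd := ((hconv.differentiable one_ne_zero) t).const_smul (Real.Gamma α)⁻¹
  refine hd.congr_of_eventuallyEq ?_
  filter_upwards [Ioi_mem_nhds ht] with τ hτ
  have hτ' : 0 < τ := hτ
  simp only [fracIntegral, Pi.smul_apply]
  congr 1
  rw [convolution_eq_swap, intervalIntegral.integral_of_le hτ'.le, integral_Ioc_eq_integral_Ioo,
    ← integral_indicator measurableSet_Ioo]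
  congr 1
  ext s
  simp only [hk, indicator, mem_Ioi, mem_Ioo, ContinuousLinearMap.lsmul_apply, sub_pos]
  by_cases h1 : s < τ
  · by_cases h2 : 0 < s
    · simp [h1, h2]
    · simp [h1, h2, h0 s (not_lt.1 h2)]
  · simp [h1]

/-- For times near `t` the integral effectively stops at `t - ε`, away from the singularity of the
kernel, so differentiation under the integral sign is legitimate. -/
lemma differentiableAt_fracIntegral_of_eq_zero_near {α : ℝ} (hα : α ∈ Ioo (0 : ℝ) 1) {T : ℝ}
    {w : ℝ → ℝ} (hw : ContinuousOn w (Icc 0 T)) {t ε : ℝ} (hε : 0 < ε) (hεt : 0 < t - ε)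
    (htT : t + ε < T) (h0 : ∀ s ∈ Ioo (t - ε) (t + ε), w s = 0) :
    DifferentiableAt ℝ (fracIntegral α w) t := by
  have hwi : ContinuousOn w (Icc 0 (t - ε)) := hw.mono (Icc_subset_Icc_right (by linarith))
  have hfar : ∀ τ ∈ Metric.ball t (ε / 2), ∀ s ∈ uIoc 0 (t - ε), ε / 2 ≤ τ - s := by
    intro τ hτ s hs
    rw [uIoc_of_le hεt.le] at hs
    rw [Metric.mem_ball, Real.dist_eq, abs_lt] at hτ
    linarith [hs.2, hτ.1]
  have hmeas : ∀ β τ : ℝ, AEStronglyMeasurable (fun s => (τ - s) ^ β * w s)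
      (volume.restrict (uIoc 0 (t - ε))) := by
    intro β τ
    have h1 : Measurable fun s : ℝ => (τ - s) ^ β := by fun_prop
    refine h1.aestronglyMeasurable.mul ?_
    rw [uIoc_of_le hεt.le]
    exact (hwi.mono Ioc_subset_Icc_self).aestronglyMeasurable measurableSet_Ioc
  have hder := intervalIntegral.hasDerivAt_integral_of_dominated_loc_of_deriv_le
    (μ := volume) (a := 0) (b := t - ε) (x₀ := t) (s := Metric.ball t (ε / 2))
    (F := fun τ s => (τ - s) ^ (α - 1) * w s)
    (F' := fun τ s => (α - 1) * ((τ - s) ^ (α - 1 - 1) * w s))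
    (bound := fun s => |α - 1| * ((ε / 2) ^ (α - 1 - 1) * |w s|))
    (Metric.ball_mem_nhds t (by linarith)) (Eventually.of_forall fun τ => hmeas _ τ)
    (intervalIntegrable_kernel_smul hα.1 t hεt.le hwi)
    ((hmeas _ t).const_mul _) ?_ ?_ ?_
  · refine (hder.2.differentiableAt.const_smul (Real.Gamma α)⁻¹).congr_of_eventuallyEq ?_
    filter_upwards [Metric.ball_mem_nhds t (half_pos hε)] with τ hτ
    rw [Metric.mem_ball, Real.dist_eq, abs_lt] at hτ
    have hle : t - ε ≤ τ := by linarith [hτ.1]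
    simp only [fracIntegral, Pi.smul_apply, smul_eq_mul]
    congr 1
    have hi1 := intervalIntegrable_kernel_smul hα.1 τ hεt.le hwi
    have hi2 := intervalIntegrable_kernel_smul hα.1 τ hle
      (hw.mono (Icc_subset_Icc hεt.le (by linarith [hτ.2])))
    simp only [smul_eq_mul] at hi1 hi2
    rw [← intervalIntegral.integral_add_adjacent_intervals hi1 hi2]
    have hz : ∫ s in (t - ε)..τ, (τ - s) ^ (α - 1) * w s = ∫ s in (t - ε)..τ, (0 : ℝ) := by
      refine intervalIntegral.integral_congr_Ioo_of_le hle fun s hs => ?_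
      rw [h0 s ⟨hs.1, by linarith [hs.2, hτ.2]⟩, mul_zero]
    rw [hz]
    simp
  · refine Eventually.of_forall fun s hs τ hτ => ?_
    have h1 := hfar τ hτ s hs
    have h2 : 0 ≤ (τ - s) ^ (α - 1 - 1) := Real.rpow_nonneg (by linarith) _
    rw [norm_mul, norm_mul, Real.norm_eq_abs, Real.norm_of_nonneg h2, Real.norm_eq_abs]
    refine mul_le_mul_of_nonneg_left (mul_le_mul_of_nonneg_right ?_ (abs_nonneg _)) (abs_nonneg _)
    exact Real.rpow_le_rpow_of_nonpos (half_pos hε) h1 (by linarith [hα.2])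
  · refine ContinuousOn.intervalIntegrable ?_
    rw [uIcc_of_le hεt.le]
    exact continuousOn_const.mul (continuousOn_const.mul hwi.abs)
  · refine Eventually.of_forall fun s hs τ hτ => ?_
    have h1 := hfar τ hτ s hs
    have h2 : HasDerivAt (fun τ : ℝ => τ - s) 1 τ := (hasDerivAt_id τ).sub_const s
    have h3 := (h2.rpow_const (p := α - 1) (Or.inl (by linarith : τ - s ≠ 0))).mul_const (w s)
    exact h3.congr_deriv (by ring)

lemma fracIntegral_add {F : Type} [NormedAddCommGroup F] [NormedSpace ℝ F] {α : ℝ} (hα : 0 < α)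
    {t : ℝ} (ht : 0 ≤ t) {u v : ℝ → F} (hu : ContinuousOn u (Icc 0 t))
    (hv : ContinuousOn v (Icc 0 t)) :
    fracIntegral α (fun s => u s + v s) t = fracIntegral α u t + fracIntegral α v t := by
  simp only [fracIntegral, smul_add]
  rw [intervalIntegral.integral_add (intervalIntegrable_kernel_smul hα t ht hu)
    (intervalIntegrable_kernel_smul hα t ht hv), smul_add]

/-- The fractional integral of a function that is continuous on `[0,T]` and `C¹` on `(0,T)` is
differentiable on `(0,T)`. -/
lemma differentiableAt_fracIntegral {α : ℝ} (hα : α ∈ Ioo (0 : ℝ) 1) {T : ℝ}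
    {w : ℝ → ℝ} (hw : ContinuousOn w (Icc 0 T)) (hw1 : ContDiffOn ℝ 1 w (Ioo 0 T)) {t : ℝ}
    (ht : t ∈ Ioo 0 T) : DifferentiableAt ℝ (fracIntegral α w) t := by
  obtain ⟨ε, hε, hε1, hε2⟩ : ∃ ε, 0 < ε ∧ 0 < t - 3 * ε ∧ t + 3 * ε < T := by
    refine ⟨min t (T - t) / 4, ?_, ?_, ?_⟩ <;>
    rcases min_cases t (T - t) with ⟨h1, h2⟩ | ⟨h1, h2⟩ <;> rw [h1] <;> linarith [ht.1, ht.2]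
  -- Split `w = χ w + (1 - χ) w`: the first part is `C¹` with compact support in `(0,T)`, the second
  -- vanishes near `t` and carries the possibly rough behaviour at the endpoints.
  let χ : ContDiffBump t := ⟨ε, 2 * ε, hε, by linarith⟩
  have hsupp : tsupport χ ⊆ Icc (t - 2 * ε) (t + 2 * ε) := by
    rw [χ.tsupport_eq, Real.closedBall_eq_Icc]
  have hsub : tsupport χ ⊆ Ioo 0 T := fun s hs =>
    ⟨by linarith [(hsupp hs).1], by linarith [(hsupp hs).2]⟩
  have hχ1 : ContDiff ℝ 1 (fun s => χ s * w s) := by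
    rw [contDiff_iff_contDiffAt]
    intro s
    by_cases hs : s ∈ tsupport χ
    · exact χ.contDiff.contDiffAt.mul (hw1.contDiffAt (isOpen_Ioo.mem_nhds (hsub hs)))
    · refine (contDiffAt_const (c := (0 : ℝ))).congr_of_eventuallyEq ?_
      filter_upwards [(notMem_tsupport_iff_eventuallyEq).1 hs] with r hr
      simp [hr]
  have hd1 : DifferentiableAt ℝ (fracIntegral α (fun s => χ s * w s)) t := by
    refine differentiableAt_fracIntegral_of_hasCompactSupport hα.1 hχ1
      (χ.hasCompactSupport.mul_right) (fun s hs => ?_) ht.1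
    have : χ s = 0 := image_eq_zero_of_notMem_tsupport fun h => by linarith [(hsub h).1]
    simp [this]
  have hc2 : ContinuousOn (fun s => (1 - χ s) * w s) (Icc 0 T) :=
    (continuous_const.sub χ.continuous).continuousOn.mul hw
  have hd2 : DifferentiableAt ℝ (fracIntegral α (fun s => (1 - χ s) * w s)) t := by
    refine differentiableAt_fracIntegral_of_eq_zero_near hα hc2 hε (by linarith) (by linarith)
      fun s hs => ?_
    have : χ s = 1 := by
      refine χ.one_of_mem_closedBall ?_
      rw [Real.closedBall_eq_Icc]
      exact ⟨hs.1.le, hs.2.le⟩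
    simp [this]
  refine (hd1.add hd2).congr_of_eventuallyEq ?_
  filter_upwards [isOpen_Ioo.mem_nhds ht] with τ hτ
  have hsubτ : Icc 0 τ ⊆ Icc 0 T := Icc_subset_Icc_right hτ.2.le
  rw [Pi.add_apply, ← fracIntegral_add hα.1 hτ.1.le hχ1.continuous.continuousOn (hc2.mono hsubτ)]
  congr 1
  ext s
  ring

end Differentiability

/-! ### The fractional chain-rule inequality -/

section Inequality

/-- At an interior zero of a nonnegative function the derivative of its fractional integral is
nonpositive. -/
lemma deriv_fracIntegral_nonpos_of_eq_zero {α : ℝ} (hα : α ∈ Ioo (0 : ℝ) 1) {T : ℝ} {q : ℝ → ℝ}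
    (hq : ContinuousOn q (Icc 0 T)) (hq0 : ∀ s ∈ Icc 0 T, 0 ≤ q s) {t D : ℝ} (ht : t ∈ Ioo 0 T)
    (hqt : q t = 0) (hqd : DifferentiableAt ℝ q t) (hD : HasDerivAt (fracIntegral α q) D t) :
    D ≤ 0 := by
  have hΓ := Real.Gamma_pos_of_pos hα.1
  -- Differentiability and `q t = 0` give `q s ≤ C |s - t|` near `t`.
  obtain ⟨C, hC⟩ := hqd.isBigO_sub.bound
  obtain ⟨δ, hδ, hball⟩ := Metric.eventually_nhds_iff.1 hC
  have hslope : Tendsto (slope (fracIntegral α q) t) (𝓝[>] t) (𝓝 D) :=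
    (hasDerivAt_iff_tendsto_slope.1 hD).mono_left (nhdsWithin_mono _ fun s hs => ne_of_gt hs)
  -- This function of `τ` will bound the right difference quotient at `t`.
  have hlim : Tendsto (fun τ => (Real.Gamma α)⁻¹ * (C * ((τ - t) ^ α / α))) (𝓝[>] t) (𝓝 0) := by
    have h1 : Continuous fun τ : ℝ => (Real.Gamma α)⁻¹ * (C * ((τ - t) ^ α / α)) := by
      have := (Real.continuous_rpow_const hα.1.le).comp (continuous_sub_right t)
      exact continuous_const.mul (continuous_const.mul (this.div_const α))
    have h2 := (h1.tendsto t).mono_left (nhdsWithin_le_nhds (s := Ioi t))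
    simpa [Real.zero_rpow hα.1.ne'] using h2
  refine le_of_tendsto_of_tendsto hslope hlim ?_
  have hnear : ∀ᶠ τ in 𝓝[>] t, τ ∈ Ioo t (min T (t + δ)) :=
    Ioo_mem_nhdsGT (lt_min ht.2 (by linarith))
  filter_upwards [hnear] with τ hτ
  have hτT : τ < T := hτ.2.trans_le (min_le_left _ _)
  have hτδ : τ < t + δ := hτ.2.trans_le (min_le_right _ _)
  have hpos : 0 < τ - t := sub_pos.2 hτ.1
  have hi1 := intervalIntegrable_kernel_smul hα.1 τ ht.1.le
    (hq.mono (Icc_subset_Icc_right ht.2.le))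
  have hi2 := intervalIntegrable_kernel_smul hα.1 τ hτ.1.le
    (hq.mono (Icc_subset_Icc ht.1.le hτT.le))
  have hi3 := intervalIntegrable_kernel_smul hα.1 t ht.1.le
    (hq.mono (Icc_subset_Icc_right ht.2.le))
  -- The contribution of the past does not grow: the kernel decreases in `τ` and `q ≥ 0`.
  have hfirst : ∫ s in (0 : ℝ)..t, (τ - s) ^ (α - 1) • q s
      ≤ ∫ s in (0 : ℝ)..t, (t - s) ^ (α - 1) • q s := by
    refine intervalIntegral.integral_mono_on_of_le_Ioo ht.1.le hi1 hi3 fun s hs => ?_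
    refine mul_le_mul_of_nonneg_right ?_ (hq0 s ⟨hs.1.le, by linarith [hs.2, ht.2]⟩)
    exact Real.rpow_le_rpow_of_nonpos (by linarith [hs.2]) (by linarith) (by linarith [hα.2])
  -- On the new interval `q ≤ C (τ - t)`, and the kernel integrates to `(τ - t)^α / α`.
  have hsecond : ∫ s in t..τ, (τ - s) ^ (α - 1) • q s ≤ (τ - t) * (C * ((τ - t) ^ α / α)) := by
    have h1 : ∫ s in t..τ, (τ - s) ^ (α - 1) • q s
        ≤ ∫ s in t..τ, (τ - s) ^ (α - 1) * (C * (τ - t)) := by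
      refine intervalIntegral.integral_mono_on_of_le_Ioo hτ.1.le hi2
        ((intervalIntegrable_kernel hα.1 τ t τ).mul_const _) fun s hs => ?_
      refine mul_le_mul_of_nonneg_left ?_ (Real.rpow_nonneg (by linarith [hs.2]) _)
      have hst : 0 < s - t := sub_pos.2 hs.1
      have h2 := hball (y := s) (by rw [Real.dist_eq, abs_of_pos hst]; linarith [hs.2])
      rw [hqt, sub_zero, Real.norm_of_nonneg (hq0 s ⟨by linarith [ht.1, hs.1], by linarith [hs.2]⟩),
        Real.norm_of_nonneg hst.le] at h2
      have hC0 : 0 ≤ C := by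
        by_contra hneg
        have := mul_neg_of_neg_of_pos (not_le.1 hneg) hst
        linarith [hq0 s ⟨by linarith [ht.1, hs.1], by linarith [hs.2]⟩]
      exact h2.trans (mul_le_mul_of_nonneg_left (by linarith [hs.2]) hC0)
    refine h1.trans (le_of_eq ?_)
    rw [intervalIntegral.integral_mul_const,
      intervalIntegral.integral_comp_sub_left (fun x => x ^ (α - 1)), sub_self,
      integral_rpow (Or.inl (by linarith [hα.1])), sub_add_cancel, Real.zero_rpow hα.1.ne', sub_zero]
    ring
  rw [slope_def_field, div_le_iff₀ hpos]
  have hsplit := intervalIntegral.integral_add_adjacent_intervals hi1 hi2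
  have hmain : ∫ s in (0 : ℝ)..τ, (τ - s) ^ (α - 1) • q s
      ≤ (∫ s in (0 : ℝ)..t, (t - s) ^ (α - 1) • q s) + (τ - t) * (C * ((τ - t) ^ α / α)) := by
    rw [← hsplit]
    exact add_le_add hfirst hsecond
  have hmul := mul_le_mul_of_nonneg_left hmain (inv_nonneg.2 hΓ.le)
  simp only [fracIntegral]
  rw [smul_eq_mul, smul_eq_mul]
  linarith

variable {X : Type} [NormedAddCommGroup X] [InnerProductSpace ℝ X] [CompleteSpace X]

lemma fracIntegral_inner {α : ℝ} (hα : 0 < α) {t : ℝ} (ht : 0 ≤ t) {G : ℝ → X}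
    (hG : ContinuousOn G (Icc 0 t)) (x : X) :
    fracIntegral α (fun s => inner ℝ x (G s)) t = inner ℝ x (fracIntegral α G t) := by
  have h := (innerSL ℝ x).intervalIntegral_comp_comm (intervalIntegrable_kernel_smul hα t ht hG)
  simp only [innerSL_apply_apply, inner_smul_right] at h
  simp only [fracIntegral, inner_smul_right, ← h, smul_eq_mul]

lemma fracIntegral_smul (α c t : ℝ) (u : ℝ → ℝ) :
    fracIntegral α (fun s => c * u s) t = c * fracIntegral α u t := by
  simp only [fracIntegral, smul_eq_mul, mul_left_comm _ c, intervalIntegral.integral_const_mul]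

lemma fracIntegral_norm_sub_sq {α : ℝ} (hα : 0 < α) {t : ℝ} (ht : 0 ≤ t) {G : ℝ → X}
    (hG : ContinuousOn G (Icc 0 t)) (x : X) :
    fracIntegral α (fun s => ‖G s - x‖ ^ 2) t
      = fracIntegral α (fun s => ‖G s‖ ^ 2) t + (-2 * inner ℝ x (fracIntegral α G t)
        + ‖x‖ ^ 2 * (t ^ α / (α * Real.Gamma α))) := by
  have hexp : (fun s => ‖G s - x‖ ^ 2)
      = fun s => ‖G s‖ ^ 2 + (-2 * inner ℝ x (G s) + ‖x‖ ^ 2) := by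
    ext s
    rw [norm_sub_sq_real, real_inner_comm]
    ring
  have hin : ContinuousOn (fun s => -2 * inner ℝ x (G s)) (Icc 0 t) :=
    continuousOn_const.mul (continuousOn_const.inner hG)
  have hsq : ContinuousOn (fun s => ‖G s‖ ^ 2) (Icc 0 t) := hG.norm.pow 2
  have hin2 : ContinuousOn (fun s => -2 * inner ℝ x (G s) + ‖x‖ ^ 2) (Icc 0 t) :=
    hin.add continuousOn_const
  rw [hexp, fracIntegral_add hα ht hsq hin2,
    fracIntegral_add hα ht hin continuousOn_const, fracIntegral_smul, fracIntegral_inner hα ht hG,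
    fracIntegral_const hα]

/-- The pointwise fractional chain-rule inequality in a Hilbert space. -/
lemma deriv_fracIntegral_norm_sq_add_le {α : ℝ} (hα : α ∈ Ioo (0 : ℝ) 1) {T : ℝ} {G : ℝ → X}
    (hG : ContinuousOn G (Icc 0 T)) (hG1 : ContDiffOn ℝ 1 G (Ioo 0 T)) {t : ℝ} (ht : t ∈ Ioo 0 T)
    {v : X} (hv : HasDerivAt (fracIntegral α G) v t) :
    deriv (fracIntegral α fun s => ‖G s‖ ^ 2) t + eta α t * ‖G t‖ ^ 2 ≤ 2 * inner ℝ (G t) v := by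
  have hd := (differentiableAt_fracIntegral hα (hG.norm.pow 2) (hG1.norm_sq ℝ) ht).hasDerivAt
  -- The vector `G t` stays frozen while the upper limit varies; only then is it set against the
  -- zero of the integrand at `s = t`.
  have hq : HasDerivAt (fracIntegral α fun s => ‖G s - G t‖ ^ 2)
      (deriv (fracIntegral α fun s => ‖G s‖ ^ 2) t
        + (-2 * inner ℝ (G t) v + ‖G t‖ ^ 2 * eta α t)) t := by
    have hin := ((innerSL ℝ (G t)).hasFDerivAt.comp_hasDerivAt t hv).const_mul (-2)
    have hpow := (hasDerivAt_rpow_div_Gamma hα.1 ht.1).const_mul (‖G t‖ ^ 2)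
    refine (hd.add (hin.add hpow)).congr_of_eventuallyEq ?_
    filter_upwards [isOpen_Ioo.mem_nhds ht] with τ hτ
    exact fracIntegral_norm_sub_sq hα.1 hτ.1.le (hG.mono (Icc_subset_Icc_right hτ.2.le)) (G t)
  have hGt : DifferentiableAt ℝ G t :=
    (hG1.contDiffAt (isOpen_Ioo.mem_nhds ht)).differentiableAt one_ne_zero
  have h := deriv_fracIntegral_nonpos_of_eq_zero hα ((hG.sub continuousOn_const).norm.pow 2)
    (fun s _ => sq_nonneg _) ht (by simp) ((hGt.sub_const _).norm_sq ℝ) hq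
  linarith

end Inequality

/-! ### Quadrature independent of the integrand -/

section RiemannSums

/-- Weighted integrals over `(0,t)` are limits of finite sums over interior nodes, with nodes and
weights that do not depend on the integrand or on its target space. -/
lemma exists_quadrature {t : ℝ} (ht : 0 < t) {k : ℝ → ℝ} (hk : IntervalIntegrable k volume 0 t) :
    ∃ (S : ℕ → Finset ℝ) (c : ℕ → ℝ → ℝ), (∀ n, ∀ y ∈ S n, y ∈ Ioo 0 t) ∧
      ∀ {F : Type} [NormedAddCommGroup F] [NormedSpace ℝ F] [CompleteSpace F] (f : ℝ → F),
        ContinuousOn f (Icc 0 t) →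
        Tendsto (fun n => ∑ y ∈ S n, c n y • f y) atTop
          (𝓝 (∫ s in (0 : ℝ)..t, k s • f s)) := by
  have hmem : t / 2 ∈ Ioo 0 t := ⟨by linarith, by linarith⟩
  -- Simple functions tending to the identity supply the nodes as their values and the weights as
  -- integrals of `k` over their level sets. The nodes stay in the open interval, where the Caputo
  -- derivative is known to equal its continuous extension.
  set p : ℕ → SimpleFunc ℝ ℝ := SimpleFunc.approxOn id measurable_id (Ioo 0 t) (t / 2) hmem with hp
  have hpmem : ∀ n s, p n s ∈ Ioo 0 t := fun n s => SimpleFunc.approxOn_mem measurable_id hmem n s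
  have hkI : IntegrableOn k (Ioc 0 t) := (intervalIntegrable_iff_integrableOn_Ioc_of_le ht.le).1 hk
  refine ⟨fun n => (p n).range, fun n y => ∫ s in Ioc 0 t, (p n ⁻¹' {y}).indicator k s,
    fun n y hy => ?_, fun {F} _ _ _ f hf => ?_⟩
  · obtain ⟨s, rfl⟩ := SimpleFunc.mem_range.1 hy
    exact hpmem n s
  have hsum : ∀ n, ∑ y ∈ (p n).range, (∫ s in Ioc 0 t, (p n ⁻¹' {y}).indicator k s) • f y
      = ∫ s in Ioc 0 t, k s • f (p n s) := by
    intro n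
    have hint : ∀ y ∈ (p n).range, Integrable (fun s => (p n ⁻¹' {y}).indicator k s • f y)
        (volume.restrict (Ioc 0 t)) := fun y _ =>
      (hkI.indicator ((p n).measurableSet_preimage {y})).smul_const (f y)
    simp only [← integral_smul_const]
    rw [← integral_finsetSum _ hint]
    congr 1
    ext s
    rw [Finset.sum_eq_single_of_mem (p n s) ((p n).mem_range_self s)]
    · simp
    · intro y _ hy
      have : s ∉ p n ⁻¹' {y} := fun h => hy h.symm
      rw [indicator_of_notMem this, zero_smul]
  obtain ⟨C, hC⟩ := isCompact_Icc.exists_bound_of_continuousOn hf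
  simp only [hsum]
  rw [intervalIntegral.integral_of_le ht.le]
  refine tendsto_integral_of_dominated_convergence (fun s => ‖k s‖ * C) (fun n => ?_)
    (hkI.norm.mul_const C) (fun n => Eventually.of_forall fun s => ?_) ?_
  · have h1 : StronglyMeasurable fun s => f (p n s) := ((p n).map f).stronglyMeasurable
    exact hkI.aestronglyMeasurable.smul h1.aestronglyMeasurable
  · rw [norm_smul]
    exact mul_le_mul_of_nonneg_left (hC _ (Ioo_subset_Icc_self (hpmem n s))) (norm_nonneg _)
  · rw [ae_restrict_iff' measurableSet_Ioc]
    refine Eventually.of_forall fun s hs => ?_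
    have hs' : s ∈ Icc 0 t := Ioc_subset_Icc_self hs
    have hps : Tendsto (fun n => p n s) atTop (𝓝[Icc 0 t] s) := by
      refine tendsto_nhdsWithin_iff.2 ⟨?_, Eventually.of_forall fun n =>
        Ioo_subset_Icc_self (hpmem n s)⟩
      exact SimpleFunc.tendsto_approxOn measurable_id hmem
        (by rw [closure_Ioo ht.ne]; exact hs')
    exact ((hf s hs').tendsto.comp hps).const_smul (k s)

end RiemannSums

/-! ### From pointwise to `L²(Ω)`-valued fractional integrals -/

section Fields

variable {F : Type} [NormedAddCommGroup F] {Ω : Set Plane}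

lemma coeFn_toL2 {f : Plane → F} (hf : MemLp f 2 (volume.restrict Ω)) :
    toL2 Ω f =ᵐ[volume.restrict Ω] f := by
  rw [toL2, dif_pos hf]
  exact hf.coeFn_toLp

lemma coeFn_sum_smul_toL2 [NormedSpace ℝ F] (S : Finset ℝ) (c : ℝ → ℝ) (u : ℝ → Plane → F)
    (hu : ∀ y ∈ S, MemLp (u y) 2 (volume.restrict Ω)) :
    (∑ y ∈ S, c y • toL2 Ω (u y) : L2 Ω F) =ᵐ[volume.restrict Ω] fun x => ∑ y ∈ S, c y • u y x := by
  induction S using Finset.induction_on with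
  | empty =>
    simp only [Finset.sum_empty]
    exact Lp.coeFn_zero F 2 (volume.restrict Ω)
  | insert y S hy ih =>
    have h1 := ih fun z hz => hu z (Finset.mem_insert_of_mem hz)
    rw [Finset.sum_insert hy]
    filter_upwards [Lp.coeFn_add (c y • toL2 Ω (u y)) (∑ z ∈ S, c z • toL2 Ω (u z)), h1,
      Lp.coeFn_smul (c y) (toL2 Ω (u y)), coeFn_toL2 (hu y (Finset.mem_insert_self y S))]
      with x h2 h3 h4 h5
    rw [h2, Pi.add_apply, h3, h4, Pi.smul_apply, h5, Finset.sum_insert hy]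

/-- If the `L²(Ω)`-valued Caputo derivative of `P` agrees on `(0,T)` with a continuous function
`G`, then the fractional integral of `G` in `L²(Ω)` is `P - P(0)`. -/
lemma fracIntegral_eq_toL2_sub {α : ℝ} (hα : α ∈ Ioo (0 : ℝ) 1) {T : ℝ} {P : ℝ → Plane → Plane}
    (hP : ∀ t ∈ Icc 0 T, MemLp (P t) 2 (volume.restrict Ω))
    (hPt : ∀ᵐ x ∂(volume.restrict Ω),
      HasL1Deriv T (fun t => P t x) ∧ HasContCaputo T α (fun t => P t x))
    (hmem : ∀ t ∈ Ioo 0 T, MemLp (caputoField α P t) 2 (volume.restrict Ω))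
    {G : ℝ → L2 Ω Plane} (hG : ContinuousOn G (Icc 0 T))
    (hGP : ∀ t ∈ Ioo 0 T, toL2 Ω (caputoField α P t) = G t) {t : ℝ} (ht : t ∈ Ioo 0 T) :
    fracIntegral α G t = toL2 Ω (P t) - toL2 Ω (P 0) := by
  obtain ⟨S, c, hS, hlim⟩ := exists_quadrature ht.1 (intervalIntegrable_kernel hα.1 t 0 t)
  have hST : ∀ n, ∀ y ∈ S n, y ∈ Ioo 0 T := fun n y hy =>
    ⟨(hS n y hy).1, (hS n y hy).2.trans ht.2⟩
  have hL2 : Tendsto (fun n => ∑ y ∈ S n, c n y • toL2 Ω (caputoField α P y)) atTop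
      (𝓝 (∫ s in (0 : ℝ)..t, (t - s) ^ (α - 1) • G s)) := by
    refine (hlim G (hG.mono (Icc_subset_Icc_right ht.2.le))).congr fun n => ?_
    exact Finset.sum_congr rfl fun y hy => by rw [hGP y (hST n y hy)]
  -- Convergence in `L²(Ω)` gives convergence at almost every `x` along a subsequence.
  obtain ⟨ns, hns, hae⟩ := (tendstoInMeasure_of_tendsto_Lp hL2).exists_seq_tendsto_ae
  have hsum : ∀ᵐ x ∂(volume.restrict Ω), ∀ n,
      (∑ y ∈ S n, c n y • toL2 Ω (caputoField α P y) : L2 Ω Plane) x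
        = ∑ y ∈ S n, c n y • caputoField α P y x :=
    ae_all_iff.2 fun n => coeFn_sum_smul_toL2 (S n) (c n) _ fun y hy => hmem y (hST n y hy)
  have h0T : (0 : ℝ) ∈ Icc 0 T := ⟨le_rfl, (ht.1.trans ht.2).le⟩
  apply Lp.ext
  simp only [fracIntegral]
  filter_upwards [hae, hsum, hPt, Lp.coeFn_sub (toL2 Ω (P t)) (toL2 Ω (P 0)),
    coeFn_toL2 (hP t (Ioo_subset_Icc_self ht)), coeFn_toL2 (hP 0 h0T),
    Lp.coeFn_smul (Real.Gamma α)⁻¹ (∫ s in (0 : ℝ)..t, (t - s) ^ (α - 1) • G s)]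
    with x h1 h2 h3 h4 h5 h6 h7
  obtain ⟨⟨hint, hprim⟩, g, hg, hgeq⟩ := h3
  -- At fixed `x` the same sums converge to the scaled fractional integral of the pointwise Caputo
  -- derivative, so the two limits agree.
  have hpt := hlim g (hg.mono (Icc_subset_Icc_right ht.2.le))
  have hfrac := fracIntegral_caputo hα ht.1.le
    (hint.mono_set (by rw [uIcc_of_le ht.1.le, uIcc_of_le (ht.1.trans ht.2).le]
                       exact Icc_subset_Icc_right ht.2.le))
  rw [fracIntegral_congr ht.1.le (hgeq.mono (Ioo_subset_Ioo_right ht.2.le)), fracIntegral] at hfrac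
  have hlimx : Tendsto (fun n => (∑ y ∈ S (ns n), c (ns n) y • toL2 Ω (caputoField α P y) :
      L2 Ω Plane) x) atTop (𝓝 (∫ s in (0 : ℝ)..t, (t - s) ^ (α - 1) • g s)) := by
    refine (hpt.comp hns.tendsto_atTop).congr fun n => ?_
    rw [h2]
    exact Finset.sum_congr rfl fun y hy => by rw [← hgeq (hST _ y hy)]; rfl
  rw [h7, Pi.smul_apply, tendsto_nhds_unique h1 hlimx, hfrac, h4, Pi.sub_apply, h5, h6]
  exact eq_sub_of_add_eq' (hprim t (Ioo_subset_Icc_self ht)).symm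

end Fields

/-! ### Energy dissipation -/

section Energy

variable {M : Medium} {α T : ℝ} {Ω : Set Plane} {E : ℝ → Plane → Plane} {H : ℝ → Plane → ℝ}
  {P : ℝ → Plane → Plane}

/-- The right-hand side of the polarization law, solved for the Caputo derivative. -/
noncomputable def polarizationRate (M : Medium) (α : ℝ) (Ω : Set Plane)
    (E P : ℝ → Plane → Plane) (t : ℝ) : L2 Ω Plane :=
  (M.tau0 ^ α)⁻¹ • ((M.eps0 * (M.epsS - M.epsInf)) • toL2 Ω (E t) - toL2 Ω (P t))

/-- Through this identity the Caputo derivative inherits the time regularity of `E` and `P`. -/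
lemma IsWeakSolution.toL2_caputoField (h : IsWeakSolution M α T Ω E H P) {t : ℝ}
    (ht : t ∈ Ioo 0 T) : toL2 Ω (caputoField α P t) = polarizationRate M α Ω E P t := by
  have hτ : M.tau0 ^ α ≠ 0 := (Real.rpow_pos_of_pos M.tau0_pos α).ne'
  rw [polarizationRate, eq_inv_smul_iff₀ hτ]
  refine ext_inner_right ℝ fun ψ => ?_
  rw [inner_smul_left, inner_sub_left, inner_smul_left]
  simp only [conj_trivial]
  linarith [h.polarization t ht ψ]

lemma IsWeakSolution.continuousOn_polarizationRate (h : IsWeakSolution M α T Ω E H P) :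
    ContinuousOn (polarizationRate M α Ω E P) (Icc 0 T) :=
  ((h.regE.continuousOn.const_smul (M.eps0 * (M.epsS - M.epsInf))).sub
    h.regP.continuousOn).const_smul (M.tau0 ^ α)⁻¹

lemma IsWeakSolution.contDiffOn_polarizationRate (h : IsWeakSolution M α T Ω E H P) :
    ContDiffOn ℝ 1 (polarizationRate M α Ω E P) (Ioo 0 T) :=
  ((h.regE.contDiffOn.const_smul _).sub h.regP.contDiffOn).const_smul _

lemma IsC1L2.hasDerivAt {F : Type} [NormedAddCommGroup F] [NormedSpace ℝ F] {u : ℝ → Plane → F}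
    (h : IsC1L2 Ω T u) {t : ℝ} (ht : t ∈ Ioo 0 T) :
    HasDerivAt (fun s => toL2 Ω (u s)) (dt Ω u t) t :=
  ((h.contDiffOn.contDiffAt (isOpen_Ioo.mem_nhds ht)).differentiableAt one_ne_zero).hasDerivAt

lemma IsWeakSolution.fracIntegral_caputoField_congr (h : IsWeakSolution M α T Ω E H P) {t : ℝ}
    (ht : t ∈ Icc 0 T) :
    fracIntegral α (fun s => ‖toL2 Ω (caputoField α P s)‖ ^ 2) t
      = fracIntegral α (fun s => ‖polarizationRate M α Ω E P s‖ ^ 2) t :=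
  fracIntegral_congr ht.1 fun s hs => by
    simp only [h.toL2_caputoField ⟨hs.1, hs.2.trans_le ht.2⟩]

lemma IsWeakSolution.hasDerivAt_fracIntegral (hα : α ∈ Ioo (0 : ℝ) 1)
    (h : IsWeakSolution M α T Ω E H P) {t : ℝ} (ht : t ∈ Ioo 0 T) :
    HasDerivAt (fracIntegral α (polarizationRate M α Ω E P)) (dt Ω P t) t := by
  refine ((h.regP.hasDerivAt ht).sub_const (toL2 Ω (P 0))).congr_of_eventuallyEq ?_
  filter_upwards [isOpen_Ioo.mem_nhds ht] with τ hτ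
  exact fracIntegral_eq_toL2_sub hα h.regP.memLp h.regPt h.memCaputo
    h.continuousOn_polarizationRate (fun s hs => h.toL2_caputoField hs) hτ

lemma IsWeakSolution.hasDerivAt_energy (hα : α ∈ Ioo (0 : ℝ) 1)
    (h : IsWeakSolution M α T Ω E H P) {t : ℝ} (ht : t ∈ Ioo 0 T) :
    HasDerivAt (energy M α Ω E H P)
      (M.tau0 ^ α * deriv (fracIntegral α fun s => ‖polarizationRate M α Ω E P s‖ ^ 2) t
        + 2 * inner ℝ (toL2 Ω (P t)) (dt Ω P t)
        + M.eps0 * (M.epsS - M.epsInf) *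
          (M.eps0 * M.epsInf * (2 * inner ℝ (toL2 Ω (E t)) (dt Ω E t))
            + M.mu0 * (2 * inner ℝ (toL2 Ω (H t)) (dt Ω H t)))) t := by
  have hd := (differentiableAt_fracIntegral hα (h.continuousOn_polarizationRate.norm.pow 2)
    (h.contDiffOn_polarizationRate.norm_sq ℝ) ht).hasDerivAt
  have hsum := ((hd.const_mul (M.tau0 ^ α)).add (h.regP.hasDerivAt ht).norm_sq).add
    ((((h.regE.hasDerivAt ht).norm_sq.const_mul (M.eps0 * M.epsInf)).add
      ((h.regH.hasDerivAt ht).norm_sq.const_mul M.mu0)).const_mul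
        (M.eps0 * (M.epsS - M.epsInf)))
  refine hsum.congr_of_eventuallyEq ?_
  filter_upwards [isOpen_Ioo.mem_nhds ht] with τ hτ
  simp only [energy, h.fracIntegral_caputoField_congr (Ioo_subset_Icc_self hτ)]
  rfl

/-- Poynting's identity. -/
lemma IsWeakSolution.poynting (h : IsWeakSolution M α T Ω E H P) {t : ℝ} (ht : t ∈ Ioo 0 T) :
    M.eps0 * M.epsInf * inner ℝ (toL2 Ω (E t)) (dt Ω E t)
      + M.mu0 * inner ℝ (toL2 Ω (H t)) (dt Ω H t)
      = -inner ℝ (toL2 Ω (E t)) (dt Ω P t) := by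
  -- Testing with `E` and `H` makes the two curl terms cancel.
  have h1 := h.ampere t ht (E t) (h.memE t ht)
  have h2 := h.faraday t ht (toL2 Ω (H t))
  rw [real_inner_comm (toL2 Ω (E t)) (dt Ω E t), real_inner_comm (toL2 Ω (E t)) (dt Ω P t)] at h1
  rw [real_inner_comm (toL2 Ω (H t)) (dt Ω H t),
    real_inner_comm (toL2 Ω (H t)) (toL2 Ω (curl Ω (E t)))] at h2
  linarith

lemma IsWeakSolution.deriv_energy_add_le (hα : α ∈ Ioo (0 : ℝ) 1)
    (h : IsWeakSolution M α T Ω E H P) {t : ℝ} (ht : t ∈ Ioo 0 T) :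
    deriv (energy M α Ω E H P) t
      + M.tau0 ^ α * eta α t * ‖toL2 Ω (caputoField α P t)‖ ^ 2 ≤ 0 := by
  rw [(h.hasDerivAt_energy hα ht).deriv, h.toL2_caputoField ht]
  have hmain := deriv_fracIntegral_norm_sq_add_le hα h.continuousOn_polarizationRate
    h.contDiffOn_polarizationRate ht (h.hasDerivAt_fracIntegral hα ht)
  have hτ : 0 ≤ M.tau0 ^ α := (Real.rpow_pos_of_pos M.tau0_pos α).le
  -- With this test function the law converts the bound `2 (G, ∂_t P)` of `hmain` into terms in `P`
  -- and `E`.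
  have hpol := h.polarization t ht (dt Ω P t)
  rw [h.toL2_caputoField ht] at hpol
  have hpoy : M.eps0 * M.epsInf * (2 * inner ℝ (toL2 Ω (E t)) (dt Ω E t))
      + M.mu0 * (2 * inner ℝ (toL2 Ω (H t)) (dt Ω H t))
      = -(2 * inner ℝ (toL2 Ω (E t)) (dt Ω P t)) := by linarith [h.poynting ht]
  rw [hpoy]
  have := mul_le_mul_of_nonneg_left hmain hτ
  linarith

/-- Continuity at `0` and `T` extends the monotonicity to the closed interval. -/
lemma IsWeakSolution.continuousOn_energy (hα : α ∈ Ioo (0 : ℝ) 1) (hT : 0 < T)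
    (h : IsWeakSolution M α T Ω E H P) : ContinuousOn (energy M α Ω E H P) (Icc 0 T) := by
  have hfrac := continuousOn_fracIntegral hα.1 hT.le (h.continuousOn_polarizationRate.norm.pow 2)
  have hsum := ((continuousOn_const (c := M.tau0 ^ α)).mul hfrac).add
    (h.regP.continuousOn.norm.pow 2) |>.add
    ((continuousOn_const (c := M.eps0 * (M.epsS - M.epsInf))).mul
      (((continuousOn_const (c := M.eps0 * M.epsInf)).mul (h.regE.continuousOn.norm.pow 2)).add
        ((continuousOn_const (c := M.mu0)).mul (h.regH.continuousOn.norm.pow 2))))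
  refine hsum.congr fun t ht => ?_
  simp only [energy, h.fracIntegral_caputoField_congr ht]
  rfl

lemma IsWeakSolution.antitoneOn_energy (hα : α ∈ Ioo (0 : ℝ) 1) (hT : 0 < T)
    (h : IsWeakSolution M α T Ω E H P) : AntitoneOn (energy M α Ω E H P) (Icc 0 T) := by
  refine antitoneOn_of_deriv_nonpos (convex_Icc 0 T) (h.continuousOn_energy hα hT) ?_ ?_
  · rw [interior_Icc]
    exact fun t ht => (h.hasDerivAt_energy hα ht).differentiableAt.differentiableWithinAt
  · rw [interior_Icc]
    intro t ht
    have hη : 0 ≤ eta α t :=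
      div_nonneg (Real.rpow_nonneg ht.1.le _) (Real.Gamma_pos_of_pos hα.1).le
    have hterm : 0 ≤ M.tau0 ^ α * eta α t * ‖toL2 Ω (caputoField α P t)‖ ^ 2 :=
      mul_nonneg (mul_nonneg (Real.rpow_pos_of_pos M.tau0_pos α).le hη) (sq_nonneg _)
    linarith [h.deriv_energy_add_le hα ht]

end Energy

end ColeCole

theorem lemma2 (M : ColeCole.Medium) (α : ℝ) (hα : α ∈ Set.Ioo (0 : ℝ) 1)
    (T : ℝ) (hT : 0 < T) (a b c d : ℝ) (hab : a < b) (hcd : c < d)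
    (E : ℝ → ColeCole.Plane → ColeCole.Plane) (H : ℝ → ColeCole.Plane → ℝ)
    (P : ℝ → ColeCole.Plane → ColeCole.Plane)
    (hsol : ColeCole.IsWeakSolution M α T (ColeCole.rectangle a b c d) E H P) :
    (∀ t ∈ Set.Ioo 0 T,
      DifferentiableAt ℝ (ColeCole.energy M α (ColeCole.rectangle a b c d) E H P) t ∧
      deriv (ColeCole.energy M α (ColeCole.rectangle a b c d) E H P) t
        + M.tau0 ^ α * ColeCole.eta α t *
          ‖ColeCole.toL2 (ColeCole.rectangle a b c d) (ColeCole.caputoField α P t)‖ ^ 2 ≤ 0) ∧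
    AntitoneOn (ColeCole.energy M α (ColeCole.rectangle a b c d) E H P) (Set.Icc 0 T) :=
  ⟨fun _ ht => ⟨(hsol.hasDerivAt_energy hα ht).differentiableAt, hsol.deriv_energy_add_le hα ht⟩,
    hsol.antitoneOn_energy hα hT⟩
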